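/- All topological spaces are Hausdorff and normed spaces are real. An open cover $\mathcal{U}$ of a space $X$ is \emph{normal} if there is a sequence $\mathcal{W}_0=\mathcal{U},\mathcal{W}_1,\mathcal{W}_2,\dots$ of open covers of $X$ such that each $\mathcal{W}_{n+1}$ star-refines $\mathcal{W}_n$, i.e. for every $V\in\mathcal{W}_{n+1}$ the union of all members of $\mathcal{W}_{n+1}$ meeting $V$ is contained in some member of $\mathcal{W}_n$. A space $X$ is \emph{PF-normal} if every point-finite open cover of $X$ is normal. \textbf{Proposition.} Let $X$ be a PF-normal space, let $E$ be a normed space (not necessarily complete), and let $\Phi$ assign to each $x\in X$ a nonempty closed convex set $\Phi(x)\subset E$. Suppose that $\Phi$ is lower semi-continuous, i.e. $\{x\in X:\Phi(x)\cap U\neq\emptyset\}$ is open in $X$ for every open $U\subset E$, and that for each $x\in X$ the set $\Phi(x)$ is either compact or contained in some finite-dimensional affine subspace of $E$. If for some $\varepsilon>0$ there is a continuous map $g:X\to E$ such that for every $x\in X$ there is $y\in\Phi(x)$ with $\|g(x)-y\|<\varepsilon$, then there is a continuous map $f:X\to E$ with $f(x)\in\Phi(x)$ for every $x\in X$. -/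

import Mathlib

open Set

/-- `𝒰` is an open cover of the space `X`. -/
def IsOpenCovering {X : Type*} [TopologicalSpace X] (𝒰 : Set (Set X)) : Prop :=
  (∀ U ∈ 𝒰, IsOpen U) ∧ ⋃₀ 𝒰 = univ

/-- The star of a set `A` with respect to a family `𝒱`: the union of all members of `𝒱`
that meet `A`. -/
def coverStar {X : Type*} (A : Set X) (𝒱 : Set (Set X)) : Set X :=
  ⋃₀ {W ∈ 𝒱 | (W ∩ A).Nonempty}

/-- `𝒱` star-refines `𝒰`: the star of every member of `𝒱` with respect to `𝒱` is contained
in some member of `𝒰`. -/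
def StarRefines {X : Type*} (𝒱 𝒰 : Set (Set X)) : Prop :=
  ∀ V ∈ 𝒱, ∃ U ∈ 𝒰, coverStar V 𝒱 ⊆ U

/-- A normal cover (in the sense of Tukey): an open cover `𝒰` which is the first term of a
sequence of open covers each of which is star-refined by the next one. -/
def IsNormalCover {X : Type*} [TopologicalSpace X] (𝒰 : Set (Set X)) : Prop :=
  ∃ 𝒲 : ℕ → Set (Set X), 𝒲 0 = 𝒰 ∧ (∀ n, IsOpenCovering (𝒲 n)) ∧
    ∀ n, StarRefines (𝒲 (n + 1)) (𝒲 n)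

/-- A family of sets is point-finite if every point lies in only finitely many members. -/
def IsPointFinite {X : Type*} (𝒰 : Set (Set X)) : Prop :=
  ∀ x : X, {U ∈ 𝒰 | x ∈ U}.Finite

/-- A space is PF-normal if every point-finite open cover of it (of any cardinality) is
normal. -/
def PFNormal (X : Type*) [TopologicalSpace X] : Prop :=
  ∀ 𝒰 : Set (Set X), IsOpenCovering 𝒰 → IsPointFinite 𝒰 → IsNormalCover 𝒰

/-- A subset of a normed space is finite-dimensional if it is contained in some
finite-dimensional affine subspace. -/
def IsFiniteDimensionalSet {E : Type*} [NormedAddCommGroup E] [NormedSpace ℝ E]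
    (S : Set E) : Prop :=
  ∃ A : AffineSubspace ℝ E, FiniteDimensional ℝ A.direction ∧ S ⊆ A

/-- `f` is a selection for the set-valued mapping `Φ`. -/
def IsSelection {X Y : Type*} (f : X → Y) (Φ : X → Set Y) : Prop :=
  ∀ x, f x ∈ Φ x

/-- `f` is an `ε`-selection for `Φ`: each `f x` lies in the open `ε`-neighbourhood of `Φ x`,
i.e. at distance less than `ε` from some point of `Φ x`. -/
def IsEpsSelection {X Y : Type*} [PseudoMetricSpace Y] (ε : ℝ) (f : X → Y)
    (Φ : X → Set Y) : Prop :=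
  ∀ x, f x ∈ Metric.thickening ε (Φ x)

open Filter Topology Metric
open scoped Uniformity

/-! Cutting `Φ x` down to `closure (Φ x ∩ ball (g x) ε)` preserves lower semicontinuity and makes
every value compact, so compact values suffice. For these, a locally finite open cover of `E` by
small sets pulls back to a point-finite open cover of `X`, since a compact set meets only finitely
many members. PF-normality makes it normal, hence uniform for a coarser pseudometrizable topology,
where a partition of unity glues constants into an approximate selection
(`PFNormal.exists_isEpsSelection`). Halving the error repeatedly gives a uniformly Cauchy sequence.
Its limits exist by compactness of the values, so `E` need not be complete. -/

/-- The points of `X × X` whose coordinates lie in a common member of `𝒲`. -/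
def coverEntourage {X : Type*} (𝒲 : Set (Set X)) : Set (X × X) :=
  {p | ∃ W ∈ 𝒲, p.1 ∈ W ∧ p.2 ∈ W}

theorem coverEntourage_trans_of_starRefines {X : Type*} {𝒱 𝒰 : Set (Set X)}
    (h : StarRefines 𝒱 𝒰) {x y z : X} (hxy : (x, y) ∈ coverEntourage 𝒱)
    (hyz : (y, z) ∈ coverEntourage 𝒱) : (x, z) ∈ coverEntourage 𝒰 := by
  obtain ⟨V, hV, hxV, hyV⟩ := hxy
  obtain ⟨V', hV', hyV', hzV'⟩ := hyz
  obtain ⟨U, hU, hVU⟩ := h V hV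
  exact ⟨U, hU, hVU ⟨V, ⟨hV, x, hxV, hxV⟩, hxV⟩, hVU ⟨V', ⟨hV', y, hyV', hyV⟩, hzV'⟩⟩

theorem coverEntourage_subset_of_starRefines {X : Type*} {𝒱 𝒰 : Set (Set X)}
    (h : StarRefines 𝒱 𝒰) : coverEntourage 𝒱 ⊆ coverEntourage 𝒰 := by
  rintro ⟨x, y⟩ hxy
  obtain ⟨V, hV, hxV, hyV⟩ := hxy
  exact coverEntourage_trans_of_starRefines h ⟨V, hV, hxV, hyV⟩ ⟨V, hV, hyV, hyV⟩

theorem IsOpenCovering.exists_mem {X : Type*} [TopologicalSpace X] {𝒲 : Set (Set X)}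
    (h : IsOpenCovering 𝒲) (x : X) : ∃ W ∈ 𝒲, x ∈ W := by
  have hx : x ∈ ⋃₀ 𝒲 := h.2 ▸ mem_univ x
  exact hx

/-- A normal cover is refined by the interiors of its members for a coarser topology which comes
from a countably generated uniformity. -/
theorem IsNormalCover.exists_uniformSpace {X : Type*} [t : TopologicalSpace X] {𝒰 : Set (Set X)}
    (h : IsNormalCover 𝒰) :
    ∃ u : UniformSpace X, (𝓤[u]).IsCountablyGenerated ∧ t ≤ u.toTopologicalSpace ∧
      ∀ x, ∃ U ∈ 𝒰, U ∈ @nhds X u.toTopologicalSpace x := by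
  obtain ⟨𝒲, h0, hcov, hstar⟩ := h
  let s : ℕ → Set (X × X) := fun n => coverEntourage (𝒲 n)
  have hs : Antitone s :=
    antitone_nat_of_succ_le fun n => coverEntourage_subset_of_starRefines (hstar n)
  let B : FilterBasis (X × X) :=
    { sets := range s
      nonempty := range_nonempty s
      inter_sets := by
        rintro _ _ ⟨m, rfl⟩ ⟨n, rfl⟩
        exact ⟨_, ⟨max m n, rfl⟩,
          subset_inter (hs (le_max_left m n)) (hs (le_max_right m n))⟩ }
  let c : UniformSpace.Core X := UniformSpace.Core.mkOfBasis B
    (by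
      rintro _ ⟨n, rfl⟩ x
      obtain ⟨W, hW, hx⟩ := (hcov n).exists_mem x
      exact ⟨W, hW, hx, hx⟩)
    (by
      rintro _ ⟨n, rfl⟩
      refine ⟨_, ⟨n, rfl⟩, ?_⟩
      rintro ⟨x, y⟩ ⟨W, hW, hx, hy⟩
      exact ⟨W, hW, hy, hx⟩)
    (by
      rintro _ ⟨n, rfl⟩
      refine ⟨_, ⟨n + 1, rfl⟩, ?_⟩
      rintro ⟨x, z⟩ ⟨y, hxy, hyz⟩
      exact coverEntourage_trans_of_starRefines (hstar n) hxy hyz)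
  let u : UniformSpace X := UniformSpace.ofCore c
  have hbasis : (𝓤[u]).HasBasis (fun _ : ℕ => True) s := by
    refine ⟨fun v => ?_⟩
    change v ∈ B.filter ↔ _
    rw [FilterBasis.mem_filter_iff]
    constructor
    · rintro ⟨_, ⟨n, rfl⟩, hn⟩
      exact ⟨n, trivial, hn⟩
    · rintro ⟨n, -, hn⟩
      exact ⟨_, ⟨n, rfl⟩, hn⟩
  have hnhds : ∀ x, (@nhds X u.toTopologicalSpace x).HasBasis (fun _ : ℕ => True)
      fun n => {y | (x, y) ∈ s n} := fun x => nhds_basis_uniformity' hbasis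
  refine ⟨u, hbasis.isCountablyGenerated, ?_, fun x => ?_⟩
  · rw [le_iff_nhds]
    intro x
    rw [(hnhds x).ge_iff]
    intro n _
    obtain ⟨W, hW, hx⟩ := (hcov n).exists_mem x
    exact mem_of_superset (((hcov n).1 W hW).mem_nhds hx) fun y hy => ⟨W, hW, hx, hy⟩
  -- The basic neighbourhood of `x` given by `𝒲 1` lies in the star of `W`, hence in a member of `𝒲
  -- 0`.
  · obtain ⟨W, hW, hx⟩ := (hcov 1).exists_mem x
    obtain ⟨U, hU, hWU⟩ := hstar 0 W hW
    refine ⟨U, h0 ▸ hU, (hnhds x).mem_iff.2 ⟨1, trivial, ?_⟩⟩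
    rintro y ⟨W', hW', hxW', hyW'⟩
    exact hWU ⟨W', ⟨hW', x, hxW', hx⟩, hyW'⟩

/-- Such a uniformity is pseudometrizable, so partitions of unity are available. -/
theorem exists_continuous_selection_of_eventually_mem {X : Type*} [UniformSpace X]
    [(𝓤 X).IsCountablyGenerated] {E : Type*} [NormedAddCommGroup E] [NormedSpace ℝ E]
    {Ψ : X → Set E} (hconv : ∀ x, Convex ℝ (Ψ x)) (hconst : ∀ x, ∃ c, ∀ᶠ y in 𝓝 x, c ∈ Ψ y) :
    ∃ f : X → E, Continuous f ∧ IsSelection f Ψ := by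
  let _ : PseudoMetricSpace X := UniformSpace.pseudoMetricSpace X
  obtain ⟨f, hf⟩ := exists_continuous_forall_mem_convex_of_local_const hconv hconst
  exact ⟨f, f.continuous, hf⟩

/-- A map with convex values has a continuous selection if, for some normal cover, its values at
the points of each member of the cover have a common point. -/
theorem IsNormalCover.exists_continuous_selection {X : Type*} [TopologicalSpace X]
    {𝒰 : Set (Set X)} (h : IsNormalCover 𝒰) {E : Type*} [NormedAddCommGroup E] [NormedSpace ℝ E]
    {Ψ : X → Set E} (hconv : ∀ x, Convex ℝ (Ψ x)) (hconst : ∀ U ∈ 𝒰, ∃ c, ∀ x ∈ U, c ∈ Ψ x) :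
    ∃ f : X → E, Continuous f ∧ IsSelection f Ψ := by
  obtain ⟨u, hu, hle, hU⟩ := h.exists_uniformSpace
  obtain ⟨f, hf, hfΨ⟩ := @exists_continuous_selection_of_eventually_mem X u hu E _ _ Ψ hconv
    fun x => by
      obtain ⟨U, hU𝒰, hUx⟩ := hU x
      obtain ⟨c, hc⟩ := hconst U hU𝒰
      exact ⟨c, mem_of_superset hUx hc⟩
  exact ⟨f, continuous_le_dom hle hf, hfΨ⟩

/-- A metric space has a locally finite open cover by sets of small diameter. -/
theorem exists_locallyFinite_isOpen_dist_lt (E : Type*) [PseudoMetricSpace E] {ε : ℝ}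
    (hε : 0 < ε) :
    ∃ V : E → Set E, (∀ i, IsOpen (V i)) ∧ ⋃ i, V i = univ ∧ LocallyFinite V ∧
      ∀ i, V i ⊆ ball i ε :=
  precise_refinement (fun i : E => ball i ε) (fun _ => isOpen_ball)
    (iUnion_eq_univ_iff.2 fun x => ⟨x, mem_ball_self hε⟩)

theorem PFNormal.exists_isEpsSelection {X : Type*} [TopologicalSpace X] (hX : PFNormal X)
    {E : Type*} [NormedAddCommGroup E] [NormedSpace ℝ E] {Ψ : X → Set E}
    (hne : ∀ x, (Ψ x).Nonempty) (hcomp : ∀ x, IsCompact (Ψ x)) (hconv : ∀ x, Convex ℝ (Ψ x))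
    (hlsc : LowerHemicontinuous Ψ) {ε : ℝ} (hε : 0 < ε) :
    ∃ f : X → E, Continuous f ∧ IsEpsSelection ε f Ψ := by
  obtain ⟨V, hVo, hVc, hVf, hVε⟩ := exists_locallyFinite_isOpen_dist_lt E hε
  rw [lowerHemicontinuous_iff_isOpen_inter_nonempty] at hlsc
  let P : E → Set X := fun i => {x | (Ψ x ∩ V i).Nonempty}
  have hcov : IsOpenCovering (range P) := by
    refine ⟨forall_mem_range.2 fun i => hlsc _ (hVo i), ?_⟩
    refine eq_univ_of_forall fun x => ?_
    obtain ⟨y, hy⟩ := hne x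
    obtain ⟨i, hi⟩ := iUnion_eq_univ_iff.1 hVc y
    exact ⟨P i, mem_range_self i, y, hy, hi⟩
  have hfin : IsPointFinite (range P) := by
    intro x
    refine ((hVf.finite_nonempty_inter_compact (hcomp x)).image P).subset ?_
    rintro _ ⟨⟨i, rfl⟩, hi⟩
    exact ⟨i, by simpa only [inter_comm] using! hi, rfl⟩
  refine (hX _ hcov hfin).exists_continuous_selection (Ψ := fun x => thickening ε (Ψ x))
    (fun x => (hconv x).thickening ε) (forall_mem_range.2 fun i => ⟨i, ?_⟩)
  rintro x ⟨y, hy, hyi⟩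
  exact mem_thickening_iff.2 ⟨y, hy, mem_ball'.1 (hVε i hyi)⟩

/-- The moving ball has open graph, and an open set meets a closure iff it meets the set. -/
theorem LowerHemicontinuous.closure_inter_ball {X E : Type*} [TopologicalSpace X]
    [PseudoMetricSpace E] {Ψ : X → Set E} (hlsc : LowerHemicontinuous Ψ) {g : X → E}
    (hg : Continuous g) (r : ℝ) : LowerHemicontinuous fun x => closure (Ψ x ∩ ball (g x) r) := by
  have hgraph : HasOpenCGraph fun x => ball (g x) r :=
    isOpen_lt (continuous_snd.dist (hg.comp continuous_fst)) continuous_const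
  have h := hlsc.inter_hasOpenCGraph hgraph
  rw [lowerHemicontinuous_iff_isOpen_inter_nonempty] at h ⊢
  intro U hU
  simpa only [closure_inter_open_nonempty_iff hU] using h U hU

theorem IsEpsSelection.nonempty_closure_inter_ball {X E : Type*} [PseudoMetricSpace E]
    {Ψ : X → Set E} {ε : ℝ} {g : X → E} (hg : IsEpsSelection ε g Ψ) (x : X) :
    (closure (Ψ x ∩ ball (g x) ε)).Nonempty := by
  obtain ⟨y, hy, hyg⟩ := mem_thickening_iff.1 (hg x)
  exact ⟨y, subset_closure ⟨hy, mem_ball'.2 hyg⟩⟩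

theorem PFNormal.exists_isEpsSelection_half {X : Type*} [TopologicalSpace X] (hX : PFNormal X)
    {E : Type*} [NormedAddCommGroup E] [NormedSpace ℝ E] {Ψ : X → Set E}
    (hcomp : ∀ x, IsCompact (Ψ x)) (hconv : ∀ x, Convex ℝ (Ψ x))
    (hlsc : LowerHemicontinuous Ψ) {ε : ℝ} (hε : 0 < ε) {g : X → E} (hg : Continuous g)
    (hgΨ : IsEpsSelection ε g Ψ) :
    ∃ f : X → E, Continuous f ∧ IsEpsSelection (ε / 2) f Ψ ∧ ∀ x, dist (g x) (f x) ≤ 2 * ε := by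
  have hsub : ∀ x, closure (Ψ x ∩ ball (g x) ε) ⊆ Ψ x := fun x =>
    closure_minimal inter_subset_left (hcomp x).isClosed
  obtain ⟨f, hf, hfΨ⟩ := hX.exists_isEpsSelection hgΨ.nonempty_closure_inter_ball
    (fun x => (hcomp x).of_isClosed_subset isClosed_closure (hsub x))
    (fun x => ((hconv x).inter (convex_ball _ _)).closure)
    (hlsc.closure_inter_ball hg ε) (half_pos hε)
  refine ⟨f, hf, fun x => thickening_subset_of_subset _ (hsub x) (hfΨ x), fun x => ?_⟩
  obtain ⟨y, hy, hyf⟩ := mem_thickening_iff.1 (hfΨ x)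
  have hyg : dist y (g x) ≤ ε :=
    closure_minimal (inter_subset_right.trans ball_subset_closedBall) isClosed_closedBall hy
  linarith [dist_triangle_right (g x) (f x) y, dist_comm y (g x)]

theorem exists_continuous_selection_of_isEpsSelection_seq {X : Type*} [TopologicalSpace X]
    {E : Type*} [PseudoMetricSpace E] {Ψ : X → Set E} (hcomp : ∀ x, IsCompact (Ψ x))
    {F : ℕ → X → E} (hF : ∀ n, Continuous (F n)) {ε : ℕ → ℝ} (hε : Tendsto ε atTop (𝓝 0))
    (hFΨ : ∀ n, IsEpsSelection (ε n) (F n) Ψ) {C : ℝ}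
    (hdist : ∀ n x, dist (F n x) (F (n + 1) x) ≤ C / 2 / 2 ^ n) :
    ∃ f : X → E, Continuous f ∧ IsSelection f Ψ := by
  have hlim : ∀ x, ∃ y ∈ Ψ x, Tendsto (fun n => F n x) atTop (𝓝 y) := by
    intro x
    choose z hz hzF using fun n => mem_thickening_iff.1 (hFΨ n x)
    obtain ⟨y, hy, φ, hφ, hzy⟩ := (hcomp x).tendsto_subseq hz
    refine ⟨y, hy, tendsto_nhds_of_cauchySeq_of_subseq
      (cauchySeq_of_le_geometric_two fun n => hdist n x) hφ.tendsto_atTop ?_⟩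
    -- The values `F (φ n) x` and the nearby points `z (φ n)` share their limit.
    refine (tendsto_iff_of_dist ?_).1 hzy
    refine squeeze_zero (fun _ => dist_nonneg) (fun n => ?_) (hε.comp hφ.tendsto_atTop)
    exact (dist_comm _ _).trans_le (hzF (φ n)).le
  choose f hfΨ hf using hlim
  refine ⟨f, ?_, hfΨ⟩
  have hunif : TendstoUniformly F f atTop := by
    rw [Metric.tendstoUniformly_iff]
    intro δ hδ
    have h0 : Tendsto (fun n : ℕ => C / 2 ^ n) atTop (𝓝 0) :=
      tendsto_const_nhds.div_atTop (tendsto_pow_atTop_atTop_of_one_lt one_lt_two)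
    filter_upwards [h0.eventually_lt_const hδ] with n hn x
    rw [dist_comm]
    exact (dist_le_of_le_geometric_two_of_tendsto (fun n => hdist n x) (hf x) n).trans_lt hn
  exact hunif.continuous (Frequently.of_forall hF)

theorem PFNormal.exists_continuous_selection_of_isCompact {X : Type*} [TopologicalSpace X]
    (hX : PFNormal X) {E : Type*} [NormedAddCommGroup E] [NormedSpace ℝ E] {Ψ : X → Set E}
    (hne : ∀ x, (Ψ x).Nonempty) (hcomp : ∀ x, IsCompact (Ψ x)) (hconv : ∀ x, Convex ℝ (Ψ x))
    (hlsc : LowerHemicontinuous Ψ) : ∃ f : X → E, Continuous f ∧ IsSelection f Ψ := by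
  have hpos : ∀ n : ℕ, (0 : ℝ) < 1 / 2 ^ n := fun n => by positivity
  obtain ⟨f₀, hf₀, hf₀Ψ⟩ := hX.exists_isEpsSelection hne hcomp hconv hlsc one_pos
  have hstep : ∀ (n : ℕ) (g : {g : X → E // Continuous g ∧ IsEpsSelection (1 / 2 ^ n) g Ψ}),
      ∃ f : {f : X → E // Continuous f ∧ IsEpsSelection (1 / 2 ^ (n + 1)) f Ψ},
        -- The bound `2 * ε` for `ε = 1 / 2 ^ n`, in geometric form with `C = 4`.
        ∀ x, dist (g.1 x) (f.1 x) ≤ 4 / 2 / 2 ^ n := by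
    rintro n ⟨g, hg, hgΨ⟩
    obtain ⟨f, hf, hfΨ, hfg⟩ :=
      hX.exists_isEpsSelection_half hcomp hconv hlsc (hpos n) hg hgΨ
    refine ⟨⟨f, hf, ?_⟩, fun x => (hfg x).trans_eq (by ring)⟩
    rwa [pow_succ, ← div_div]
  choose next hnext using hstep
  let F : ∀ n : ℕ, {f : X → E // Continuous f ∧ IsEpsSelection (1 / 2 ^ n) f Ψ} := fun n =>
    Nat.rec ⟨f₀, hf₀, by simpa using hf₀Ψ⟩ (fun n g => next n g) n
  exact exists_continuous_selection_of_isEpsSelection_seq hcomp (F := fun n => (F n).1)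
    (fun n => (F n).2.1)
    (tendsto_const_nhds.div_atTop (tendsto_pow_atTop_atTop_of_one_lt one_lt_two))
    (fun n => (F n).2.2) fun n => hnext n (F n)

theorem IsFiniteDimensionalSet.isCompact_of_isClosed {E : Type*} [NormedAddCommGroup E]
    [NormedSpace ℝ E] {S K : Set E} (hS : IsFiniteDimensionalSet S) (hKS : K ⊆ S)
    (hK : IsClosed K) (hKb : Bornology.IsBounded K) : IsCompact K := by
  obtain ⟨A, hA, hSA⟩ := hS
  rcases K.eq_empty_or_nonempty with rfl | ⟨p, hp⟩
  · exact isCompact_empty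
  -- `A` may miss the origin; translation by `p` identifies it with its direction, a proper space.
  have hi : Isometry fun v : A.direction => (v : E) + p :=
    Isometry.of_dist_eq fun v w => by simp [Subtype.dist_eq]
  have hKr : K ⊆ range fun v : A.direction => (v : E) + p := fun y hy =>
    ⟨⟨y - p, A.vsub_mem_direction (hSA (hKS hy)) (hSA (hKS hp))⟩, by simp⟩
  rw [← image_preimage_eq_of_subset hKr]
  exact (isCompact_of_isClosed_isBounded (hK.preimage hi.continuous)
    (hi.antilipschitz.isBounded_preimage hKb)).image hi.continuous

theorem mainTheorem7 {X : Type*} [TopologicalSpace X] [T2Space X] (hX : PFNormal X)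
    {E : Type*} [NormedAddCommGroup E] [NormedSpace ℝ E] (Φ : X → Set E)
    (hΦ_nonempty : ∀ x, (Φ x).Nonempty) (hΦ_closed : ∀ x, IsClosed (Φ x))
    (hΦ_convex : ∀ x, Convex ℝ (Φ x)) (hΦ_lsc : LowerHemicontinuous Φ)
    (hΦ : ∀ x, IsCompact (Φ x) ∨ IsFiniteDimensionalSet (Φ x))
    (hε : ∃ ε : ℝ, 0 < ε ∧ ∃ g : X → E, Continuous g ∧ IsEpsSelection ε g Φ) :
    ∃ f : X → E, Continuous f ∧ IsSelection f Φ := by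
  obtain ⟨ε, -, g, hg, hgΦ⟩ := hε
  have hsub : ∀ x, closure (Φ x ∩ ball (g x) ε) ⊆ Φ x := fun x =>
    closure_minimal inter_subset_left (hΦ_closed x)
  have hcomp : ∀ x, IsCompact (closure (Φ x ∩ ball (g x) ε)) := fun x =>
    (hΦ x).elim (fun h => h.of_isClosed_subset isClosed_closure (hsub x)) fun h =>
      h.isCompact_of_isClosed (hsub x) isClosed_closure
        (isBounded_ball.subset inter_subset_right).closure
  obtain ⟨f, hf, hfΦ⟩ := hX.exists_continuous_selection_of_isCompact
    hgΦ.nonempty_closure_inter_ball hcomp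
    (fun x => ((hΦ_convex x).inter (convex_ball _ _)).closure)
    (hΦ_lsc.closure_inter_ball hg ε)
  exact ⟨f, hf, fun x => hsub x (hfΦ x)⟩
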